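/- Consider a (possibly infinite) set $S$ of stations and a finite set $Z$ of vehicle trips. A trip $z$ serves stations $s_{z,0},\dots,s_{z,n_z}$; on leg $k\in\{0,\dots,n_z-1\}$ it departs from $s_{z,k}$ at time $d_{z,k}\in\mathbb R$ and arrives at $s_{z,k+1}$ at time $a_{z,k}>d_{z,k}$, where $a_{z,k}\le d_{z,k+1}$ for $k+1<n_z$, and it has a capacity $\nu_z\ge 0$. The time-expanded graph $G=(V,E)$ has an on-platform node $(s,t)$ for every station $s$ and time $t$ at which some vehicle departs from or arrives at $s$, and a departure node $D_{z,k}$ (of time $d_{z,k}$) and an arrival node $A_{z,k}$ (of time $a_{z,k}$) for every leg; write $\theta(v)$ for the time of a node $v$. Its edges are: waiting edges between time-consecutive on-platform nodes of the same station, boarding edges $b_{z,k}=((s_{z,k},d_{z,k}),D_{z,k})$, driving edges $b_{z,k}^+=(D_{z,k},A_{z,k})$ of capacity $\nu_z$, alighting edges $(A_{z,k},(s_{z,k+1},a_{z,k}))$, and dwelling edges $(A_{z,k},D_{z,k+1})$ for $k+1<n_z$. Let $I$ be a finite set of commodities. Commodity $i$ has an origin $s_i$ and a destination $t_i$ in $S$,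 an interval $\Theta_i\subseteq\mathbb R$ of feasible departure times, a target arrival time $T_i\in\mathbb R$, penalty factors $\beta_i,\gamma_i^+,\gamma_i^-\ge0$, a demand $Q_i\ge0$, and an outside option of constant cost $\pi_{\varnothing_i}\in\mathbb R$ (elastic demand is modelled by splitting the agents into commodities with a common willingness to travel, expressed by the outside option). Its strategy set $\mathcal P_i$ consists of the outside option $\varnothing_i$, which uses no edges, and of all directed paths $p$ in $G$ from an on-platform node $v$ of $s_i$ with $\theta(v)\in\Theta_i$ to an on-platform node $w$ of $t_i$. With $\mathrm{arr}_p=\theta(w)$ and $\tau_p=\theta(w)-\theta(v)$, such a path has the cost \[\pi_{i,p}=\beta_i\tau_p+\gamma_i^+\max\{0,\mathrm{arr}_p-T_i\}+\gamma_i^-\max\{0,T_i-\mathrm{arr}_p\},\] and $\pi_{i,\varnothing_i}=\pi_{\varnothing_i}$. A flow is a vector $f=(f_{i,p})_{i\in I,\,p\in\mathcal P_i}$ of nonnegative reals; $f_e=\sum_{i,\,p:\,e\in p}f_{i,p}$ is its value on the edge $e$. It is feasible if $\sum_{p\in\mathcal P_i}f_{i,p}=Q_i$ for all $i$ and $f_e\le\nu_z$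 for every driving edge $e$ of every trip $z$. For $p,q\in\mathcal P_i$ and $0<\varepsilon\le f_{i,p}$ let $f_{i,p\to q}(\varepsilon)=f+\varepsilon(1_{i,q}-1_{i,p})$; this deviation is admissible if $(f_{i,p\to q}(\varepsilon))_{e^+}\le\nu_z$ for every boarding edge $e=b_{z,k}$ of $q$. The strategy $q$ is an available alternative to $p$ for $i$ given $f$ if $f_{i,p\to q}(\varepsilon)$ is admissible for some $\varepsilon\in(0,f_{i,p}]$. A feasible flow $f$ is a (side-constrained) user equilibrium if for all $i\in I$ and $p\in\mathcal P_i$ with $f_{i,p}>0$ one has $\pi_{i,p}\le\pi_{i,q}$ for every available alternative $q$ to $p$ for $i$ given $f$. Theorem. If the instance has fixed departure times, i.e. $\Theta_i$ is a singleton for every $i\in I$, then a side-constrained user equilibrium exists. -/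

import Mathlib

/-- A timetable for the vehicle trips `Z` on the stations `S`. Trip `z` serves the stations
`station z 0, …, station z (legs z)`; on its `k`-th leg it leaves `station z k` at time `dep z k` and
arrives at `station z (k+1)` at time `arr z k`. -/
structure TransitNetwork (S Z : Type*) where
  legs : Z → ℕ
  station : (z : Z) → Fin (legs z + 1) → S
  dep : (z : Z) → Fin (legs z) → ℝ
  arr : (z : Z) → Fin (legs z) → ℝ
  dep_lt_arr : ∀ (z : Z) (k : Fin (legs z)), dep z k < arr z k
  arr_le_dep : ∀ (z : Z) (k : ℕ) (hk : k + 1 < legs z),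
    arr z ⟨k, Nat.lt_of_succ_lt hk⟩ ≤ dep z ⟨k + 1, hk⟩
  /-- The vehicle capacity `ν_z`. -/
  capacity : Z → ℝ
  capacity_nonneg : ∀ z, 0 ≤ capacity z

namespace TransitNetwork

variable {S Z I : Type*}

/-- The pairs (station, time) at which some vehicle departs or arrives. -/
def events (N : TransitNetwork S Z) : Set (S × ℝ) :=
  Set.range (fun x : (z : Z) × Fin (N.legs z) => (N.station x.1 x.2.castSucc, N.dep x.1 x.2)) ∪
  Set.range (fun x : (z : Z) × Fin (N.legs z) => (N.station x.1 x.2.succ, N.arr x.1 x.2))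

theorem dep_mem_events (N : TransitNetwork S Z) (z : Z) (k : Fin (N.legs z)) :
    (N.station z k.castSucc, N.dep z k) ∈ N.events := Or.inl ⟨⟨z, k⟩, rfl⟩

theorem arr_mem_events (N : TransitNetwork S Z) (z : Z) (k : Fin (N.legs z)) :
    (N.station z k.succ, N.arr z k) ∈ N.events := Or.inr ⟨⟨z, k⟩, rfl⟩

/-- Nodes of the time-expanded graph. The departure node `departure z k` belongs to the
departure of `z` from its stop `k`, the arrival node `arrival z k` to its arrival at stop `k+1`. -/
inductive Node (N : TransitNetwork S Z) where
  | platform (s : S) (t : ℝ) (h : (s, t) ∈ N.events)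
  | departure (z : Z) (k : Fin (N.legs z))
  | arrival (z : Z) (k : Fin (N.legs z))

/-- The time `θ(v)` of a node. -/
def Node.time {N : TransitNetwork S Z} : N.Node → ℝ
  | .platform _ t _ => t
  | .departure z k => N.dep z k
  | .arrival z k => N.arr z k

/-- Edges of the time-expanded graph. A waiting edge joins two consecutive on-platform nodes of
a station; a dwelling edge exists at every stop where the vehicle arrives and departs again. -/
inductive Edge (N : TransitNetwork S Z) where
  | waiting (s : S) (t t' : ℝ) (h : (s, t) ∈ N.events) (h' : (s, t') ∈ N.events) (hlt : t < t')
      (hcons : ∀ u, (s, u) ∈ N.events → ¬ (t < u ∧ u < t'))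
  | boarding (z : Z) (k : Fin (N.legs z))
  | driving (z : Z) (k : Fin (N.legs z))
  | alighting (z : Z) (k : Fin (N.legs z))
  | dwelling (z : Z) (k : ℕ) (hk : k + 1 < N.legs z)

namespace Edge

variable {N : TransitNetwork S Z}

/-- The tail of an edge. -/
def src : N.Edge → N.Node
  | waiting s t _ h _ _ _ => .platform s t h
  | boarding z k => .platform (N.station z k.castSucc) (N.dep z k) (N.dep_mem_events z k)
  | driving z k => .departure z k
  | alighting z k => .arrival z k
  | dwelling z k hk => .arrival z ⟨k, Nat.lt_of_succ_lt hk⟩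

/-- The head of an edge. -/
def tgt : N.Edge → N.Node
  | waiting s _ t' _ h' _ _ => .platform s t' h'
  | boarding z k => .departure z k
  | driving z k => .arrival z k
  | alighting z k => .platform (N.station z k.succ) (N.arr z k) (N.arr_mem_events z k)
  | dwelling z k hk => .departure z ⟨k + 1, hk⟩

/-- The traversal time `τ_e`. -/
def traversalTime (e : N.Edge) : ℝ := e.tgt.time - e.src.time

end Edge

/-- `IsWalk v l w`: the edges of `l`, traversed in this order, lead from `v` to `w`. -/
def IsWalk {N : TransitNetwork S Z} : N.Node → List N.Edge → N.Node → Prop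
  | v, [], w => v = w
  | v, e :: l, w => e.src = v ∧ IsWalk e.tgt l w

/-- A directed path in the time-expanded graph (no node is visited twice). -/
@[ext]
structure Path (N : TransitNetwork S Z) where
  start : N.Node
  finish : N.Node
  edges : List N.Edge
  isWalk : IsWalk start edges finish
  nodup : (start :: edges.map Edge.tgt).Nodup

/-- The traversal time `τ_p`. -/
def Path.traversalTime {N : TransitNetwork S Z} (p : N.Path) : ℝ :=
  (p.edges.map Edge.traversalTime).sum

/-- The arrival time `arr_p`. -/
def Path.arrivalTime {N : TransitNetwork S Z} (p : N.Path) : ℝ := p.finish.time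

section Finiteness

variable (N : TransitNetwork S Z)

instance [Finite Z] : Finite N.events :=
  ((Set.finite_range _).union (Set.finite_range _)).to_subtype

instance [Finite Z] : Finite N.Node := by
  let g : N.events ⊕ ((z : Z) × Fin (N.legs z)) ⊕ ((z : Z) × Fin (N.legs z)) → N.Node :=
    Sum.elim (fun x => .platform x.1.1 x.1.2 x.2)
      (Sum.elim (fun x => .departure x.1 x.2) (fun x => .arrival x.1 x.2))
  refine Finite.of_surjective g ?_
  rintro (⟨s, t, h⟩ | ⟨z, k⟩ | ⟨z, k⟩)
  · exact ⟨.inl ⟨(s, t), h⟩, rfl⟩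
  · exact ⟨.inr (.inl ⟨z, k⟩), rfl⟩
  · exact ⟨.inr (.inr ⟨z, k⟩), rfl⟩

instance [Finite Z] : Finite N.Edge := by
  refine Finite.of_injective (fun e : N.Edge => (e.src, e.tgt)) ?_
  rintro (_ | _ | _ | _ | _) (_ | _ | _ | _ | _) h <;>
    simp only [Edge.src, Edge.tgt, Prod.mk.injEq, Node.platform.injEq, Node.departure.injEq,
      Node.arrival.injEq, reduceCtorEq, and_false, false_and] at h
  · obtain ⟨⟨rfl, rfl⟩, -, rfl⟩ := h; rfl
  · obtain ⟨-, rfl, h⟩ := h; cases h; rfl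
  · obtain ⟨⟨rfl, h⟩, -⟩ := h; cases h; rfl
  · obtain ⟨⟨rfl, h⟩, -⟩ := h; cases h; rfl
  · obtain ⟨⟨rfl, h⟩, -⟩ := h; simp at h; subst h; rfl

instance [Finite Z] : Finite N.Path := by
  classical
  have := Fintype.ofFinite N.Edge
  refine Finite.of_injective
    (β := N.Node × N.Node × {l : List N.Edge // l.Nodup})
    (fun p => (p.start, p.finish, ⟨p.edges, (List.nodup_cons.1 p.nodup).2.of_map _⟩)) ?_
  intro p q h
  simp only [Prod.mk.injEq, Subtype.mk.injEq] at h
  exact Path.ext h.1 h.2.1 h.2.2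

end Finiteness

/-- A commodity of non-atomic agents. -/
structure Commodity (S : Type*) where
  origin : S
  destination : S
  /-- The interval `Θ` of feasible departure times. -/
  departureTimes : Set ℝ
  ordConnected : departureTimes.OrdConnected
  /-- The target arrival time `T`. -/
  target : ℝ
  /-- Penalty factors of the travel time, of late arrival and of early arrival. -/
  β : ℝ
  γLate : ℝ
  γEarly : ℝ
  β_nonneg : 0 ≤ β
  γLate_nonneg : 0 ≤ γLate
  γEarly_nonneg : 0 ≤ γEarly
  /-- The demand volume `Q`. -/
  demand : ℝ
  demand_nonneg : 0 ≤ demand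
  /-- The cost of the outside option. -/
  outsideCost : ℝ

variable (N : TransitNetwork S Z)

/-- The paths that start during `Θ` at an on-platform node of the origin and end at an
on-platform node of the destination. -/
def CommodityPath (c : Commodity S) : Type _ :=
  {p : N.Path // (∃ t h, p.start = .platform c.origin t h ∧ t ∈ c.departureTimes) ∧
    ∃ t h, p.finish = .platform c.destination t h}

instance [Finite Z] (c : Commodity S) : Finite (N.CommodityPath c) :=
  inferInstanceAs (Finite {_p : N.Path // _})

noncomputable instance [Finite Z] (c : Commodity S) : Fintype (N.CommodityPath c) :=
  Fintype.ofFinite _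

/-- The strategy set of a commodity; `none` is the outside option. -/
abbrev Strategy (c : Commodity S) : Type _ := Option (N.CommodityPath c)

variable {N}

/-- The edges used by a strategy. -/
def Strategy.edges {c : Commodity S} : N.Strategy c → List N.Edge
  | none => []
  | some p => p.1.edges

/-- The experienced cost `π_{i,p}` of a strategy. -/
noncomputable def Strategy.cost {c : Commodity S} : N.Strategy c → ℝ
  | none => c.outsideCost
  | some p => c.β * p.1.traversalTime + c.γLate * max 0 (p.1.arrivalTime - c.target) +
      c.γEarly * max 0 (c.target - p.1.arrivalTime)

/-- The instance has fixed departure times: every `Θ_i` is a singleton. -/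
def FixedDepartureTimes (C : I → Commodity S) : Prop :=
  ∀ i, ∃ θ : ℝ, (C i).departureTimes = {θ}

variable (N) in
/-- Real vectors indexed by the commodity-strategy pairs. -/
abbrev FlowVector (C : I → Commodity S) : Type _ := (i : I) → N.Strategy (C i) → ℝ

namespace FlowVector

variable {C : I → Commodity S}

open Classical in
/-- The total flow `f_e` on an edge. -/
noncomputable def edgeFlow [Fintype I] [Finite Z] (f : N.FlowVector C) (e : N.Edge) : ℝ :=
  ∑ i, ∑ p : N.Strategy (C i), if e ∈ p.edges then f i p else 0

/-- All path flows are nonnegative and every commodity routes exactly its demand. -/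
def DemandFeasible [Finite Z] (f : N.FlowVector C) : Prop :=
  (∀ i p, 0 ≤ f i p) ∧ ∀ i, ∑ p : N.Strategy (C i), f i p = (C i).demand

/-- No driving edge carries more flow than the capacity of its vehicle. -/
def CapacityFeasible [Fintype I] [Finite Z] (f : N.FlowVector C) : Prop :=
  ∀ (z : Z) (k : Fin (N.legs z)), f.edgeFlow (.driving z k) ≤ N.capacity z

/-- A feasible flow. -/
def Feasible [Fintype I] [Finite Z] (f : N.FlowVector C) : Prop :=
  f.DemandFeasible ∧ f.CapacityFeasible

open Classical in
/-- The `ε`-deviation `f_{i,p→q}(ε) = f + ε (1_{i,q} - 1_{i,p})`. -/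
noncomputable def deviate (f : N.FlowVector C) (i : I) (p q : N.Strategy (C i)) (ε : ℝ) :
    N.FlowVector C :=
  f + ε • (Pi.single i (Pi.single q 1) - Pi.single i (Pi.single p 1))

/-- The deviation `f_{i,p→q}(ε)` is admissible: no boarding edge of `q` leads to a driving edge
that is overfilled after the deviation. -/
def AdmissibleDeviation [Fintype I] [Finite Z] (f : N.FlowVector C) (i : I)
    (p q : N.Strategy (C i)) (ε : ℝ) : Prop :=
  ∀ (z : Z) (k : Fin (N.legs z)), Edge.boarding z k ∈ q.edges →
    (f.deviate i p q ε).edgeFlow (.driving z k) ≤ N.capacity z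

/-- The available alternatives to `p` for commodity `i`; an `ε`-deviation from `p` requires
`ε ≤ f_{i,p}`. -/
def availableAlternatives [Fintype I] [Finite Z] (f : N.FlowVector C) (i : I)
    (p : N.Strategy (C i)) : Set (N.Strategy (C i)) :=
  {q | ∃ ε : ℝ, 0 < ε ∧ ε ≤ f i p ∧ f.AdmissibleDeviation i p q ε}

/-- Side-constrained user equilibria. -/
def IsUserEquilibrium [Fintype I] [Finite Z] (f : N.FlowVector C) : Prop :=
  f.Feasible ∧ ∀ (i : I) (p : N.Strategy (C i)), 0 < f i p →
    ∀ q ∈ f.availableAlternatives i p, p.cost ≤ q.cost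

end FlowVector

end TransitNetwork

/-! An equilibrium is found as a fractional stable solution of a hypergraph with preferences. Its
vertices are the commodities, with their demands as capacities, and the legs, with the vehicle
capacities. Its hyperedges are the pairs of a commodity and a strategy, incident to that commodity
and to the legs driven. A commodity prefers low cost; a leg prefers passengers who boarded early
and, among equals, low cost. By Scarf's lemma there is a flow in which every strategy is blocked at
a saturated vertex that likes all its current users at least as much (`exists_fractional_stable`,
`exists_isStable`).

Such a flow is an equilibrium. Let `p` be used and `q` be available. Since the departure time is
fixed, `q` can be rerouted at no cost to a strategy `q'` that boards only where `p` boards or where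
`q` boards a leg not driven by `p`, hence with spare capacity (`Strategy.exists_splice`). If `q'` is
blocked at its commodity, `p` costs no more. If it is blocked at a leg, all users of that leg
boarded no later than `q'`. So the leg where `q'` boarded is full, and its passengers stay on board
up to the blocking leg (`edgeFlow_eq_capacity_of_dominated`). Being full, it is boarded by `p` too.
Thus `p` uses the blocking leg without having boarded earlier than `q'`, and can be ranked at least
as high only by costing no more.

Scarf's lemma is proved by parity. The dominating sets together with the all-slack set form a cycle
mod 2, and the feasible supports of a nondegenerate system form a cocycle mod 2, so they share an
even number of sets. The all-slack set is one of them; any other is the desired dominating support.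
Perturbation and compactness remove nondegeneracy. -/

/-! ### Pairing of cycles and cocycles mod 2 -/

/-- Over the full simplex on a finite vertex set, a mod-2 cycle `𝒟` and a mod-2 cocycle `ℱ` of the
same dimension have an even number of common members. -/
theorem Finset.even_card_inter_of_cycle_of_cocycle {V : Type*} [DecidableEq V] {n : ℕ}
    {𝒟 ℱ : Finset (Finset V)} (h𝒟 : ∀ D ∈ 𝒟, D.card = n) (hℱ : ∀ F ∈ ℱ, F.card = n)
    (hcycle : ∀ K : Finset V, K.card + 1 = n → Even (𝒟.filter (K ⊆ ·)).card)
    (hcocycle : ∀ M : Finset V, M.card = n + 1 → Even (ℱ.filter (· ⊆ M)).card) (v : V) :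
    Even (𝒟 ∩ ℱ).card := by
  have heq : ∀ {D F : Finset V}, D ∈ 𝒟 → F ∈ ℱ → F ⊆ D → F = D := fun hD hF h =>
    Finset.eq_of_subset_of_card_le h (by rw [h𝒟 _ hD, hℱ _ hF])
  -- The cone with apex `v` over the members of `𝒟` avoiding `v` has boundary `𝒟`: mod 2, a set lies
  -- in an odd number of these cones exactly if it belongs to `𝒟`. For `v ∈ F` this is the cycle
  -- condition at `F.erase v`.
  have hcount : ∀ F ∈ ℱ,
      (((𝒟.filter (v ∉ ·)).filter (F ⊆ insert v ·)).card : ZMod 2) = if F ∈ 𝒟 then 1 else 0 := by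
    intro F hF
    have hsingle : ∀ P : Finset V → Prop, ∀ [DecidablePred P], (∀ D ∈ 𝒟, (P D ↔ F = D)) →
        ((𝒟.filter P).card : ZMod 2) = if F ∈ 𝒟 then 1 else 0 := by
      intro P _ hP
      rw [Finset.filter_congr hP, Finset.filter_eq]
      split_ifs <;> simp
    by_cases hv : v ∈ F
    · have hK : (F.erase v).card + 1 = n := by rw [Finset.card_erase_add_one hv, hℱ F hF]
      have h0 : ((𝒟.filter (F.erase v ⊆ ·)).card : ZMod 2) = 0 :=
        (ZMod.natCast_eq_zero_iff_even).2 (hcycle _ hK)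
      rw [← Finset.card_filter_add_card_filter_not (s := 𝒟.filter (F.erase v ⊆ ·)) (v ∈ ·),
        Finset.filter_filter, Finset.filter_filter, Nat.cast_add, hsingle] at h0
      · rw [Finset.filter_filter]
        have : 𝒟.filter (fun D => v ∉ D ∧ F ⊆ insert v D) =
            𝒟.filter (fun D => F.erase v ⊆ D ∧ v ∉ D) :=
          Finset.filter_congr fun D _ => by rw [Finset.subset_insert_iff, and_comm]
        rw [this]
        generalize ((𝒟.filter (fun D => F.erase v ⊆ D ∧ v ∉ D)).card : ZMod 2) = a at *
        split_ifs at h0 ⊢ <;> revert a <;> decide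
      · intro D hD
        refine ⟨fun h => heq hD hF ?_, ?_⟩
        · rw [← Finset.insert_erase hv]
          exact Finset.insert_subset h.2 h.1
        · rintro rfl
          exact ⟨Finset.erase_subset _ _, hv⟩
    · rw [Finset.filter_filter]
      refine hsingle _ fun D hD => ⟨fun h => heq hD hF ?_, ?_⟩
      · exact (Finset.subset_insert_iff_of_notMem hv).1 h.2
      · rintro rfl
        exact ⟨hv, Finset.subset_insert _ _⟩
  -- Each cone `insert v D` contains an even number of members of `ℱ`; double counting then gives
  -- the parity of the intersection.
  have hzero : ∑ D ∈ 𝒟.filter (v ∉ ·), ((ℱ.filter (· ⊆ insert v D)).card : ZMod 2) = 0 := by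
    refine Finset.sum_eq_zero fun D hD => (ZMod.natCast_eq_zero_iff_even).2 (hcocycle _ ?_)
    rw [Finset.mem_filter] at hD
    rw [Finset.card_insert_of_notMem hD.2, h𝒟 D hD.1]
  have hswap : ∑ D ∈ 𝒟.filter (v ∉ ·), ((ℱ.filter (· ⊆ insert v D)).card : ZMod 2) =
      ∑ F ∈ ℱ, (((𝒟.filter (v ∉ ·)).filter (F ⊆ insert v ·)).card : ZMod 2) := by
    simp only [Finset.card_filter, Nat.cast_sum]
    exact Finset.sum_comm
  rw [hswap, Finset.sum_congr rfl hcount, Finset.sum_boole, Finset.filter_mem_eq_inter,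
    Finset.inter_comm] at hzero
  exact (ZMod.natCast_eq_zero_iff_even).1 hzero

/-! ### Dominating sets form a cycle mod 2 -/

section Dominating

variable {R X L : Type*} [LinearOrder L]

/-- A set of columns is dominating for the row orders `c` if every column is, in some row, weakly
below all columns of the set. -/
def IsDominating {R V L : Type*} [LE L] (c : R → V → L) (D : Finset V) : Prop :=
  ∀ v, ∃ i, ∀ d ∈ D, c i v ≤ c i d

/-- The row orders of the Scarf lemma: the slack column of row `i` is the least in row `i`, and in
every other row it is above all proper columns. -/
structure IsScarfOrder (c : R → R ⊕ X → L) : Prop where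
  injective : ∀ i, Function.Injective (c i)
  slack_le : ∀ i v, c i (Sum.inl i) ≤ c i v
  lt_slack : ∀ i j x, j ≠ i → c i (Sum.inr x) < c i (Sum.inl j)

variable [Fintype R] [Fintype X] [DecidableEq R] [DecidableEq X] {c : R → R ⊕ X → L}

theorem Finset.exists_insert_eq_of_subset_of_card {V : Type*} [DecidableEq V] {K D : Finset V}
    (h : K ⊆ D) (hcard : K.card + 1 = D.card) : ∃ v ∉ K, D = insert v K := by
  obtain ⟨v, hv, rfl⟩ := (Finset.exists_eq_insert_iff (s := K) (t := D)).2 ⟨h, hcard⟩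
  exact ⟨v, hv, rfl⟩

open Classical in
/-- The dominating sets with as many columns as there are rows, together with the set of all
slack columns. -/
noncomputable def dominatingCycle (c : R → R ⊕ X → L) : Finset (Finset (R ⊕ X)) :=
  Finset.univ.filter fun D => D.card = Fintype.card R ∧
    (IsDominating c D ∨ D = Finset.univ.map Function.Embedding.inl)

theorem mem_dominatingCycle {D : Finset (R ⊕ X)} :
    D ∈ dominatingCycle c ↔ D.card = Fintype.card R ∧
      (IsDominating c D ∨ D = Finset.univ.map Function.Embedding.inl) := by
  simp [dominatingCycle]

/-- `K` misses a single slack column `a`. One completion is the all-slack set. Any other adds a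
proper column; since the slack columns in `K` are least in their rows, domination of proper columns
must happen in row `a`, which forces the greatest proper column of that row. -/
theorem IsScarfOrder.even_card_of_subset_slack [Nonempty X] (hc : IsScarfOrder c)
    {K : Finset (R ⊕ X)} (hK : K.card + 1 = Fintype.card R)
    (hsub : K ⊆ Finset.univ.map Function.Embedding.inl) :
    Even ((dominatingCycle c).filter (K ⊆ ·)).card := by
  obtain ⟨v, hvK, hS⟩ := Finset.exists_insert_eq_of_subset_of_card hsub
    (by rw [hK, Finset.card_map, Finset.card_univ])
  obtain ⟨a, rfl⟩ : ∃ a : R, v = Sum.inl a := by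
    have : v ∈ Finset.univ.map (Function.Embedding.inl : R ↪ R ⊕ X) := by simp [hS]
    simpa [eq_comm] using this
  have hmem : ∀ i, i ≠ a → (Sum.inl i : R ⊕ X) ∈ K := by
    intro i hi
    have : (Sum.inl i : R ⊕ X) ∈ Finset.univ.map (Function.Embedding.inl : R ↪ R ⊕ X) := by simp
    rw [hS, Finset.mem_insert] at this
    exact this.resolve_left fun h => hi (Sum.inl_injective h)
  have hinr : ∀ x, (Sum.inr x : R ⊕ X) ∉ K := fun x hx => by simpa using hsub hx
  obtain ⟨x, hx⟩ := Finite.exists_max fun x : X => c a (Sum.inr x)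
  have hset : (dominatingCycle c).filter (K ⊆ ·) = {insert (Sum.inl a) K, insert (Sum.inr x) K} := by
    ext D
    simp only [Finset.mem_filter, mem_dominatingCycle, Finset.mem_insert, Finset.mem_singleton]
    constructor
    · rintro ⟨⟨hcard, hD⟩, hKD⟩
      obtain ⟨w, hwK, rfl⟩ := Finset.exists_insert_eq_of_subset_of_card hKD (hK.trans hcard.symm)
      rcases w with j | y
      · left
        by_cases hj : j = a
        · rw [hj]
        · exact absurd (hmem j hj) hwK
      · right
        rcases hD with hD | hD
        · obtain ⟨i, hi⟩ := hD (Sum.inr x)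
          by_cases hia : i = a
          · subst hia
            have := hc.injective i
              (le_antisymm (hx y) (hi _ (Finset.mem_insert_self _ _)))
            rw [this]
          · have h := hi _ (Finset.mem_insert_of_mem (hmem i hia))
            exact absurd (hc.injective i (le_antisymm h (hc.slack_le i _))) (by simp)
        · have : (Sum.inr y : R ⊕ X) ∈ Finset.univ.map (Function.Embedding.inl : R ↪ R ⊕ X) :=
            hD ▸ Finset.mem_insert_self _ _
          simp at this
    · rintro (rfl | rfl)
      · refine ⟨⟨?_, Or.inr hS.symm⟩, Finset.subset_insert _ _⟩
        rw [Finset.card_insert_of_notMem hvK, hK]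
      · refine ⟨⟨?_, Or.inl ?_⟩, Finset.subset_insert _ _⟩
        · rw [Finset.card_insert_of_notMem (hinr x), hK]
        · rintro (i | y)
          · exact ⟨i, fun d _ => hc.slack_le i d⟩
          · refine ⟨a, fun d hd => ?_⟩
            rcases Finset.mem_insert.1 hd with rfl | hd
            · exact hx y
            · rcases d with j | z
              · exact (hc.lt_slack a j y fun h => hvK (h ▸ hd)).le
              · exact absurd hd (hinr z)
  rw [hset, Finset.card_pair]
  · exact even_two
  · intro h
    have : (Sum.inr x : R ⊕ X) ∈ insert (Sum.inl a) K := h ▸ Finset.mem_insert_self _ _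
    simp [hinr x] at this

/-- This is Scarf's ordinal pivot. If `K` has a dominating completion, each column of `K` is minimal
over `K` in some row. As there is one row more than columns, exactly two rows `a` and `b` share
their minimizer. A new column must become the minimum of row `a` or of row `b`, and each choice
determines it. -/
theorem IsScarfOrder.even_card_of_inr_mem (hc : IsScarfOrder c) {K : Finset (R ⊕ X)}
    (hK : K.card + 1 = Fintype.card R) {y : X} (hy : Sum.inr y ∈ K) :
    Even ((dominatingCycle c).filter (K ⊆ ·)).card := by
  have hmem : ∀ D, D ∈ (dominatingCycle c).filter (K ⊆ ·) ↔
      ∃ v ∉ K, D = insert v K ∧ IsDominating c D := by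
    intro D
    simp only [Finset.mem_filter, mem_dominatingCycle]
    constructor
    · rintro ⟨⟨hcard, hD⟩, hKD⟩
      obtain ⟨w, hwK, rfl⟩ := Finset.exists_insert_eq_of_subset_of_card hKD (hK.trans hcard.symm)
      refine ⟨w, hwK, rfl, hD.resolve_right fun h => ?_⟩
      have : (Sum.inr y : R ⊕ X) ∈ Finset.univ.map (Function.Embedding.inl : R ↪ R ⊕ X) :=
        h ▸ Finset.mem_insert_of_mem hy
      simp at this
    · rintro ⟨v, hv, rfl, hD⟩
      exact ⟨⟨by rw [Finset.card_insert_of_notMem hv, hK], Or.inl hD⟩, Finset.subset_insert _ _⟩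
  rcases ((dominatingCycle c).filter (K ⊆ ·)).eq_empty_or_nonempty with hempty | ⟨D₀, hD₀⟩
  · simp [hempty]
  obtain ⟨v₀, -, rfl, hdom⟩ := (hmem D₀).1 hD₀
  have hmin : ∀ i, ∃ k ∈ K, ∀ k' ∈ K, c i k ≤ c i k' := fun i =>
    K.exists_min_image (c i) ⟨_, hy⟩
  choose m hmK hm using hmin
  have hmuniq : ∀ i, ∀ k ∈ K, (∀ k' ∈ K, c i k ≤ c i k') → k = m i := fun i k hk h =>
    hc.injective i (le_antisymm (h _ (hmK i)) (hm i k hk))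
  obtain ⟨a, -, b, -, hab, hmab⟩ := Finset.exists_ne_map_eq_of_card_lt_of_maps_to
    (s := Finset.univ) (t := K) (f := m) (by rw [Finset.card_univ]; omega) (fun i _ => hmK i)
  have hsurj : ∀ k ∈ K, ∃ i, k = m i := fun k hk => by
    obtain ⟨i, hi⟩ := hdom k
    exact ⟨i, hmuniq i k hk fun k' hk' => hi k' (Finset.mem_insert_of_mem hk')⟩
  have hbelow : ∀ w, ∃ i, c i w ≤ c i (m i) := fun w => by
    obtain ⟨i, hi⟩ := hdom w
    exact ⟨i, hi _ (Finset.mem_insert_of_mem (hmK i))⟩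
  have hnonslack : ∀ i j, m i = Sum.inl j → j = i := by
    intro i j h
    by_contra hij
    exact absurd (hm i _ hy) (not_le.2 (h ▸ hc.lt_slack i j y hij))
  -- the unique completion of `K` whose new column is the minimum in row `i`
  have hexists : ∀ i j, i ≠ j → m i = m j → ∃ v, (∀ l, l ≠ i → c l (m l) < c l v) ∧
      (∀ w, (∀ l, l ≠ i → c l (m l) < c l w) → c i w ≤ c i v) ∧ v ∉ K ∧ c i v ≤ c i (m i) ∧
      IsDominating c (insert v K) := by
    intro i j hij hmij
    -- The slack column of row `i` competes for the maximum, so there is a candidate.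
    have hne : (Sum.inl i : R ⊕ X) ∈
        Finset.univ.filter fun w => ∀ l, l ≠ i → c l (m l) < c l w := by
      simp only [Finset.mem_filter, Finset.mem_univ, true_and]
      intro l hl
      rcases h : m l with j' | x
      · obtain rfl := hnonslack l j' h
        exact lt_of_le_of_ne (hc.slack_le _ _)
          fun h' => hl (Sum.inl_injective (hc.injective _ h'))
      · exact hc.lt_slack l i x hl.symm
    obtain ⟨v, hv, hvmax⟩ := Finset.exists_max_image _ (c i) ⟨_, hne⟩
    simp only [Finset.mem_filter, Finset.mem_univ, true_and] at hv hvmax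
    have hvi : c i v ≤ c i (m i) := by
      obtain ⟨l, hl⟩ := hbelow v
      by_cases h : l = i
      · exact h ▸ hl
      · exact absurd (hv l h) (not_lt.2 hl)
    refine ⟨v, hv, hvmax, fun hvK => ?_, hvi, fun w => ?_⟩
    · obtain ⟨l, hl⟩ := hsurj v hvK
      by_cases h : l = i
      · rw [h, hmij] at hl
        exact absurd (hv j hij.symm) (hl ▸ lt_irrefl _)
      · exact absurd (hv l h) (hl ▸ lt_irrefl _)
    · by_cases hw : ∀ l, l ≠ i → c l (m l) < c l w
      · refine ⟨i, fun d hd => ?_⟩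
        rcases Finset.mem_insert.1 hd with rfl | hd
        · exact hvmax w hw
        · exact (hvmax w hw).trans (hvi.trans (hm i d hd))
      · push Not at hw
        obtain ⟨l, hl, hlw⟩ := hw
        refine ⟨l, fun d hd => ?_⟩
        rcases Finset.mem_insert.1 hd with rfl | hd
        · exact hlw.trans (hv l hl).le
        · exact hlw.trans (hm l d hd)
  obtain ⟨va, hva, hvamax, hvaK, hvale, hvadom⟩ := hexists a b hab hmab
  obtain ⟨vb, hvb, hvbmax, hvbK, -, hvbdom⟩ := hexists b a hab.symm hmab.symm
  have hset : (dominatingCycle c).filter (K ⊆ ·) = {insert va K, insert vb K} := by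
    ext D
    rw [hmem]
    simp only [Finset.mem_insert, Finset.mem_singleton]
    constructor
    · rintro ⟨v, hvK, rfl, hD⟩
      choose r hr using fun w : R ⊕ X => hD w
      have hrm : ∀ k ∈ K, m (r k) = k := fun k hk =>
        (hmuniq (r k) k hk fun k' hk' => hr k k' (Finset.mem_insert_of_mem hk')).symm
      have hrv : ∀ k ∈ K, r k ≠ r v := fun k hk h => by
        have h1 := hr k v (Finset.mem_insert_self _ _)
        have h2 := hr v k (Finset.mem_insert_of_mem hk)
        rw [h] at h1
        exact hvK (hc.injective _ (le_antisymm h1 h2) ▸ hk)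
      -- The dominating rows of the columns of `K` are distinct and differ from that of `v`. By
      -- counting they are all the other rows, so each of these is the dominating row of its own
      -- minimizer.
      have himage : K.image r = Finset.univ.erase (r v) := by
        refine Finset.eq_of_subset_of_card_le ?_ ?_
        · intro i hi
          obtain ⟨k, hk, rfl⟩ := Finset.mem_image.1 hi
          exact Finset.mem_erase.2 ⟨hrv k hk, Finset.mem_univ _⟩
        · rw [Finset.card_erase_of_mem (Finset.mem_univ _), Finset.card_univ,
            Finset.card_image_of_injOn]
          · omega
          · intro k hk k' hk' h
            rw [← hrm k hk, ← hrm k' hk', h]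
      have hrow : ∀ i, i ≠ r v → r (m i) = i := by
        intro i hi
        have : i ∈ K.image r := himage ▸ Finset.mem_erase.2 ⟨hi, Finset.mem_univ _⟩
        obtain ⟨k, hk, rfl⟩ := Finset.mem_image.1 this
        rw [hrm k hk]
      have habove : ∀ l, l ≠ r v → c l (m l) < c l v := by
        intro l hl
        have h := hr (m l) v (Finset.mem_insert_self _ _)
        rw [hrow l hl] at h
        exact lt_of_le_of_ne h fun h' => hvK (hc.injective l h' ▸ hmK l)
      have hmax : ∀ w, (∀ l, l ≠ r v → c l (m l) < c l w) → c (r v) w ≤ c (r v) v := by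
        intro w hw
        by_cases h : r w = r v
        · exact h ▸ hr w v (Finset.mem_insert_self _ _)
        · exact absurd (hr w _ (Finset.mem_insert_of_mem (hmK _))) (not_le.2 (hw _ h))
      by_cases ha : r v = a
      · left
        rw [ha] at habove hmax
        rw [hc.injective a (le_antisymm (hvamax v habove) (hmax va hva))]
      · by_cases hb : r v = b
        · right
          rw [hb] at habove hmax
          rw [hc.injective b (le_antisymm (hvbmax v habove) (hmax vb hvb))]
        · have h1 := hrow a (Ne.symm ha)
          rw [hmab, hrow b (Ne.symm hb)] at h1
          exact absurd h1.symm hab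
    · rintro (rfl | rfl)
      · exact ⟨va, hvaK, rfl, hvadom⟩
      · exact ⟨vb, hvbK, rfl, hvbdom⟩
  rw [hset, Finset.card_pair]
  · exact even_two
  · intro h
    have : va ∈ insert vb K := h ▸ Finset.mem_insert_self _ _
    rcases Finset.mem_insert.1 this with h | h
    · exact absurd (hvb a hab) (not_lt.2 (h ▸ hvale))
    · exact hvaK h

/-- Every set with one column less than there are rows lies in an even number of members of the
dominating cycle. -/
theorem IsScarfOrder.even_card_dominatingCycle [Nonempty X] (hc : IsScarfOrder c)
    {K : Finset (R ⊕ X)} (hK : K.card + 1 = Fintype.card R) :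
    Even ((dominatingCycle c).filter (K ⊆ ·)).card := by
  by_cases h : ∃ y, Sum.inr y ∈ K
  · obtain ⟨y, hy⟩ := h
    exact hc.even_card_of_inr_mem hK hy
  · refine hc.even_card_of_subset_slack hK ?_
    rintro (i | y) hk
    · simp
    · exact absurd ⟨y, hk⟩ h

end Dominating

/-! ### Feasible supports form a cocycle mod 2 -/

section FeasibleSupport

variable {R V : Type*} [Fintype V]

/-- The nonnegative solutions of the linear system `B x = b`. -/
structure IsNonnegSolution (B : Matrix R V ℝ) (b : R → ℝ) (x : V → ℝ) : Prop where
  nonneg : ∀ v, 0 ≤ x v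
  mulVec_eq : B.mulVec x = b

variable {B : Matrix R V ℝ} {b : R → ℝ}

/-- A vanishing sum of nonnegative products has only zero terms. In effect the solution polytope is
bounded: a nonzero kernel vector has a negative entry. -/
theorem Matrix.eq_zero_of_nonneg_of_mulVec_eq_zero (hB : ∀ i v, 0 ≤ B i v)
    (hcol : ∀ v, ∃ i, 0 < B i v) {w : V → ℝ} (hw : ∀ v, 0 ≤ w v) (h : B.mulVec w = 0) : w = 0 := by
  funext v
  obtain ⟨i, hi⟩ := hcol v
  have hsum : ∑ u, B i u * w u = 0 := congrFun h i
  have := (Finset.sum_eq_zero_iff_of_nonneg fun u _ => mul_nonneg (hB i u) (hw u)).1 hsum v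
    (Finset.mem_univ v)
  exact (mul_eq_zero.1 this).resolve_left hi.ne.symm

/-- Moving from a nonnegative solution along a kernel vector until a coordinate vanishes. -/
theorem IsNonnegSolution.exists_add_smul (hB : ∀ i v, 0 ≤ B i v) (hcol : ∀ v, ∃ i, 0 < B i v)
    {x w : V → ℝ} (hx : IsNonnegSolution B b x) (hw : B.mulVec w = 0) (hw0 : w ≠ 0)
    (hxw : ∀ v, x v = 0 → 0 ≤ w v) :
    ∃ t : ℝ, 0 < t ∧ IsNonnegSolution B b (x + t • w) ∧ ∃ v, w v < 0 ∧ (x + t • w) v = 0 := by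
  have hneg : (Finset.univ.filter fun v => w v < 0).Nonempty := by
    by_contra h
    rw [Finset.not_nonempty_iff_eq_empty, Finset.filter_eq_empty_iff] at h
    exact hw0 (Matrix.eq_zero_of_nonneg_of_mulVec_eq_zero hB hcol
      (fun v => not_lt.1 (h (Finset.mem_univ v))) hw)
  -- Ratio test: the step length is the smallest `x v / (-w v)` over the decreasing coordinates.
  obtain ⟨v, hv, hmin⟩ := Finset.exists_min_image _ (fun v => x v / (-w v)) hneg
  simp only [Finset.mem_filter, Finset.mem_univ, true_and] at hv hmin
  have hpos : ∀ u, w u < 0 → 0 < x u := fun u hu =>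
    lt_of_le_of_ne (hx.nonneg u) fun h => absurd (hxw u h.symm) (not_le.2 hu)
  have ht : 0 < x v / (-w v) := div_pos (hpos v hv) (neg_pos.2 hv)
  refine ⟨x v / (-w v), ht, ⟨fun u => ?_, ?_⟩, v, hv, ?_⟩
  · simp only [Pi.add_apply, Pi.smul_apply, smul_eq_mul]
    rcases lt_or_ge (w u) 0 with hu | hu
    · have h := hmin u hu
      rw [le_div_iff₀ (neg_pos.2 hu)] at h
      linarith
    · exact add_nonneg (hx.nonneg u) (mul_nonneg ht.le hu)
  · rw [Matrix.mulVec_add, Matrix.mulVec_smul, hw, smul_zero, add_zero, hx.mulVec_eq]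
  · simp only [Pi.add_apply, Pi.smul_apply, smul_eq_mul]
    have := hv.ne
    field_simp
    ring

/-- A compactness principle: if for right-hand sides arbitrarily close to `b` there are
nonnegative solutions supported on members of a finite family, then so there are for `b`. -/
theorem exists_isNonnegSolution_of_approx (hB : ∀ i v, 0 ≤ B i v) (hcol : ∀ v, ∃ i, 0 < B i v)
    {P : Finset V → Prop}
    (h : ∀ ε : ℝ, 0 < ε → ∃ D x b', P D ∧ (∀ i, b i < b' i ∧ b' i < b i + ε) ∧
      IsNonnegSolution B b' x ∧ ∀ v ∉ D, x v = 0) :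
    ∃ D x, P D ∧ IsNonnegSolution B b x ∧ ∀ v ∉ D, x v = 0 := by
  choose D x b' hP hb' hx hxD using fun n : ℕ => h (1 / ((n : ℝ) + 1)) (by positivity)
  have hlim : Filter.Tendsto b' Filter.atTop (nhds b) := by
    refine tendsto_pi_nhds.2 fun i => ?_
    refine tendsto_of_tendsto_of_tendsto_of_le_of_le tendsto_const_nhds
      (h := fun n : ℕ => b i + 1 / ((n : ℝ) + 1)) ?_ (fun n => (hb' n i).1.le)
      (fun n => (hb' n i).2.le)
    simpa using (tendsto_const_nhds (x := b i)).add (tendsto_one_div_add_atTop_nhds_zero_nat (𝕜 := ℝ))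
  choose r hr using hcol
  have hbound : ∀ n, x n ∈ Set.Icc (0 : V → ℝ) fun v => (b (r v) + 1) / B (r v) v := by
    refine fun n => ⟨(hx n).nonneg, fun v => ?_⟩
    rw [le_div_iff₀ (hr v), mul_comm]
    have h1 : B (r v) v * x n v ≤ ∑ u, B (r v) u * x n u :=
      Finset.single_le_sum (f := fun u => B (r v) u * x n u)
        (fun u _ => mul_nonneg (hB _ u) ((hx n).nonneg u)) (Finset.mem_univ v)
    have h2 : ∑ u, B (r v) u * x n u = b' n (r v) := congrFun (hx n).mulVec_eq (r v)
    have h3 : (1 : ℝ) / ((n : ℝ) + 1) ≤ 1 := by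
      rw [div_le_one (by positivity)]
      linarith [n.cast_nonneg (α := ℝ)]
    linarith [(hb' n (r v)).2]
  -- There are finitely many sets, so one of them serves infinitely many approximations; the
  -- solutions along it are bounded and have a convergent subsequence.
  obtain ⟨D₀, hD₀⟩ := Finite.exists_infinite_fiber D
  have hfreq : ∃ᶠ n in Filter.atTop, D n = D₀ :=
    Nat.frequently_atTop_iff_infinite.2 (Set.infinite_coe_iff.1 hD₀)
  obtain ⟨φ, hφ, hDφ⟩ := Filter.extraction_of_frequently_atTop hfreq
  obtain ⟨y, hy, ψ, hψ, hlimy⟩ := isCompact_Icc.tendsto_subseq fun n => hbound (φ n)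
  refine ⟨D₀, y, hDφ 0 ▸ hP (φ 0), ⟨hy.1, ?_⟩, fun v hv => ?_⟩
  · have hcont : Continuous fun z : V → ℝ => B.mulVec z := by fun_prop
    have h1 := (hcont.tendsto y).comp hlimy
    have h2 := (hlim.comp hφ.tendsto_atTop).comp hψ.tendsto_atTop
    refine tendsto_nhds_unique h1 (h2.congr fun n => ?_)
    exact ((hx _).mulVec_eq).symm
  · refine tendsto_nhds_unique ((continuous_apply v).tendsto y |>.comp hlimy)
      (tendsto_const_nhds.congr fun n => ?_)
    exact (hxD (φ (ψ n)) v (by rw [hDφ]; exact hv)).symm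

variable [Fintype R]

open Classical in
/-- The sets with as many columns as there are rows that support a nonnegative solution. -/
noncomputable def feasibleSupports (B : Matrix R V ℝ) (b : R → ℝ) : Finset (Finset V) :=
  Finset.univ.filter fun F => F.card = Fintype.card R ∧
    ∃ x, IsNonnegSolution B b x ∧ ∀ v ∉ F, x v = 0

theorem mem_feasibleSupports {F : Finset V} : F ∈ feasibleSupports B b ↔
    F.card = Fintype.card R ∧ ∃ x, IsNonnegSolution B b x ∧ ∀ v ∉ F, x v = 0 := by
  simp [feasibleSupports]

/-- Every nonnegative solution has at least as many nonzero coordinates as there are rows. -/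
def IsNondegenerate (B : Matrix R V ℝ) (b : R → ℝ) : Prop :=
  ∀ x, IsNonnegSolution B b x → ∀ F : Finset V, (∀ v ∉ F, x v = 0) → Fintype.card R ≤ F.card

/-- Right-hand sides of nondegenerate systems exist arbitrarily close above a given one. -/
theorem exists_isNondegenerate (B : Matrix R V ℝ) (b : R → ℝ) {ε : ℝ} (hε : 0 < ε) :
    ∃ b', (∀ i, b i < b' i ∧ b' i < b i + ε) ∧ IsNondegenerate B b' := by
  classical
  let 𝒯 : Finset (Finset V) := Finset.univ.filter fun F => F.card < Fintype.card R
  let W : Finset V → Submodule ℝ (R → ℝ) := fun F =>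
    Submodule.span ℝ (F.image fun v i => B i v : Finset (R → ℝ))
  -- A degenerate right-hand side lies in the span of fewer columns than there are rows. Finitely
  -- many such proper subspaces form a null set, which cannot cover an open box.
  have hnull : MeasureTheory.volume (⋃ F ∈ 𝒯, (W F : Set (R → ℝ))) = 0 := by
    refine (MeasureTheory.measure_biUnion_null_iff 𝒯.countable_toSet).2 fun F hF => ?_
    refine MeasureTheory.Measure.addHaar_submodule _ _ fun htop => ?_
    have h1 : Module.finrank ℝ (W F) ≤ _ := finrank_span_finset_le_card _
    rw [htop, finrank_top, Module.finrank_fintype_fun_eq_card] at h1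
    have h2 : F.card < Fintype.card R := by simpa [𝒯] using hF
    exact absurd (h1.trans Finset.card_image_le) (not_le.2 h2)
  have hopen : IsOpen (Set.univ.pi fun i => Set.Ioo (b i) (b i + ε)) :=
    isOpen_set_pi Set.finite_univ fun i _ => isOpen_Ioo
  have hpos : 0 < MeasureTheory.volume (Set.univ.pi fun i => Set.Ioo (b i) (b i + ε)) :=
    hopen.measure_pos _ ⟨fun i => b i + ε / 2, fun i _ => ⟨by simp [hε], by simp [hε]⟩⟩
  obtain ⟨b', hb', hgen⟩ : ((Set.univ.pi fun i => Set.Ioo (b i) (b i + ε)) \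
      ⋃ F ∈ 𝒯, (W F : Set (R → ℝ))).Nonempty := by
    refine MeasureTheory.nonempty_of_measure_ne_zero (μ := MeasureTheory.volume) ?_
    rw [MeasureTheory.measure_sdiff_null hnull]
    exact hpos.ne'
  refine ⟨b', fun i => hb' i (Set.mem_univ i), fun x hx F hF => ?_⟩
  by_contra hcard
  refine hgen (Set.mem_iUnion₂.2 ⟨F, by simpa [𝒯] using hcard, ?_⟩)
  have : b' = ∑ v ∈ F, x v • fun i => B i v := by
    rw [← hx.mulVec_eq]
    funext i
    simp only [Matrix.mulVec, dotProduct, Finset.sum_apply, Pi.smul_apply, smul_eq_mul]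
    rw [← Finset.sum_subset (Finset.subset_univ F) fun u _ hu => by rw [hF u hu, mul_zero]]
    exact Finset.sum_congr rfl fun u _ => mul_comm _ _
  rw [this]
  exact Submodule.sum_mem _ fun v hv => Submodule.smul_mem _ _
    (Submodule.subset_span (Finset.mem_coe.2 (Finset.mem_image_of_mem _ hv)))

variable [DecidableEq V]

theorem IsNondegenerate.pos_of_mem (hb : IsNondegenerate B b) {x : V → ℝ}
    (hx : IsNonnegSolution B b x) {F : Finset V} (hF : F.card = Fintype.card R)
    (hxF : ∀ v ∉ F, x v = 0) {v : V} (hv : v ∈ F) : 0 < x v := by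
  refine lt_of_le_of_ne (hx.nonneg v) fun h => ?_
  have := hb x hx (F.erase v) fun u hu => by
    by_cases huv : u = v
    · rw [huv, ← h]
    · exact hxF u fun hu' => hu (Finset.mem_erase.2 ⟨huv, hu'⟩)
  have := Finset.card_erase_lt_of_mem hv
  omega

theorem Matrix.exists_mulVec_eq_zero_of_card_lt (B : Matrix R V ℝ) {M : Finset V}
    (hM : Fintype.card R < M.card) :
    ∃ w : V → ℝ, w ≠ 0 ∧ B.mulVec w = 0 ∧ ∀ v ∉ M, w v = 0 := by
  obtain ⟨f, hf, hf0, v, hv, hv0⟩ : ∃ f : V → ℝ, ∑ v ∈ M, f v • (fun i => B i v) = 0 ∧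
      (∀ v ∉ M, f v = 0) ∧ ∃ v ∈ M, f v ≠ 0 := by
    have hdep : ¬ LinearIndependent ℝ fun v : M => (fun i => B i v : R → ℝ) := by
      intro h
      have := h.fintype_card_le_finrank
      rw [Module.finrank_fintype_fun_eq_card, Fintype.card_coe] at this
      omega
    rw [Fintype.not_linearIndependent_iff] at hdep
    obtain ⟨g, hg, v, hv⟩ := hdep
    refine ⟨fun u => if h : u ∈ M then g ⟨u, h⟩ else 0, ?_, fun u hu => by simp [hu], v, v.2, ?_⟩
    · rw [← Finset.sum_coe_sort, ← hg]
      exact Finset.sum_congr rfl fun u _ => by simp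
    · simpa using hv
  refine ⟨f, fun h => hv0 (congrFun h v), ?_, hf0⟩
  funext i
  have := congrFun hf i
  simp only [Finset.sum_apply, Pi.smul_apply, smul_eq_mul, Pi.zero_apply] at this
  rw [Pi.zero_apply, ← this, Matrix.mulVec, dotProduct]
  rw [← Finset.sum_subset (Finset.subset_univ M) fun u _ hu => by rw [hf0 u hu, mul_zero]]
  exact Finset.sum_congr rfl fun u _ => mul_comm _ _

/-- In a nondegenerate system, every set with one column more than there are rows contains an even
number of feasible supports. -/
theorem IsNondegenerate.even_card_feasibleSupports (hB : ∀ i v, 0 ≤ B i v)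
    (hcol : ∀ v, ∃ i, 0 < B i v) (hb : IsNondegenerate B b) {M : Finset V}
    (hM : M.card = Fintype.card R + 1) : Even ((feasibleSupports B b).filter (· ⊆ M)).card := by
  have hmem : ∀ F, F ∈ (feasibleSupports B b).filter (· ⊆ M) ↔
      ∃ j ∈ M, F = M.erase j ∧ ∃ x, IsNonnegSolution B b x ∧ x j = 0 ∧ ∀ v ∉ M, x v = 0 := by
    intro F
    rw [Finset.mem_filter, mem_feasibleSupports]
    constructor
    · rintro ⟨⟨hF, x, hx, hxF⟩, hFM⟩
      obtain ⟨j, hj, rfl⟩ := Finset.exists_insert_eq_of_subset_of_card hFM (by rw [hF, hM])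
      exact ⟨j, Finset.mem_insert_self _ _, (Finset.erase_insert hj).symm, x, hx, hxF j hj,
        fun v hv => hxF v fun h => hv (Finset.mem_insert_of_mem h)⟩
    · rintro ⟨j, hj, rfl, x, hx, hxj, hxM⟩
      refine ⟨⟨by rw [Finset.card_erase_of_mem hj, hM]; rfl, x, hx, fun v hv => ?_⟩,
        Finset.erase_subset _ _⟩
      by_cases h : v = j
      · rw [h, hxj]
      · exact hxM v fun hvM => hv (Finset.mem_erase.2 ⟨h, hvM⟩)
  have hpos : ∀ j ∈ M, ∀ x, IsNonnegSolution B b x → x j = 0 → (∀ v ∉ M, x v = 0) →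
      ∀ v ∈ M, v ≠ j → 0 < x v := by
    intro j hj x hx hxj hxM v hv hvj
    refine hb.pos_of_mem hx (F := M.erase j) (by rw [Finset.card_erase_of_mem hj, hM]; rfl)
      (fun u hu => ?_) (Finset.mem_erase.2 ⟨hvj, hv⟩)
    by_cases h : u = j
    · rw [h, hxj]
    · exact hxM u fun huM => hu (Finset.mem_erase.2 ⟨h, huM⟩)
  rcases ((feasibleSupports B b).filter (· ⊆ M)).eq_empty_or_nonempty with hempty | ⟨F₁, hF₁⟩
  · simp [hempty]
  obtain ⟨j₁, hj₁, -, x₁, hx₁, hxj₁, hxM₁⟩ := (hmem F₁).1 hF₁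
  -- Otherwise one could move from `x₁` along `w`, keeping coordinate `j₁` zero, until a second
  -- coordinate in `M` vanishes, against nondegeneracy. So the solutions supported in `M` lie on one
  -- line; the two ends of the segment give the two supports.
  have hker : ∀ w, B.mulVec w = 0 → (∀ v ∉ M, w v = 0) → w j₁ = 0 → w = 0 := by
    intro w hw hwM hwj
    by_contra hw0
    have hsupp : ∀ v, x₁ v = 0 → w v = 0 := by
      intro v hv
      by_cases hvM : v ∈ M
      · by_cases hvj : v = j₁
        · rw [hvj, hwj]
        · exact absurd hv (hpos j₁ hj₁ x₁ hx₁ hxj₁ hxM₁ v hvM hvj).ne'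
      · exact hwM v hvM
    obtain ⟨t, -, hsol, v, hwv, hv⟩ := hx₁.exists_add_smul hB hcol hw hw0 fun v hv =>
      (hsupp v hv).ge
    have hvM : v ∈ M := by
      by_contra h
      exact hwv.ne (hwM v h)
    have hvj : v ≠ j₁ := by
      rintro rfl
      exact hwv.ne hwj
    exact (hpos j₁ hj₁ _ hsol (by simp [hxj₁, hwj]) (fun u hu => by simp [hxM₁ u hu, hwM u hu])
      v hvM hvj).ne' hv
  obtain ⟨w, hw, hwM, hwj⟩ : ∃ w : V → ℝ, B.mulVec w = 0 ∧ (∀ v ∉ M, w v = 0) ∧ 0 < w j₁ := by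
    obtain ⟨w, hw0, hw, hwM⟩ := B.exists_mulVec_eq_zero_of_card_lt (M := M) (by omega)
    rcases lt_trichotomy (w j₁) 0 with h | h | h
    · exact ⟨-w, by rw [Matrix.mulVec_neg, hw, neg_zero], fun v hv => by simp [hwM v hv],
        by simpa using h⟩
    · exact absurd (hker w hw hwM h) hw0
    · exact ⟨w, hw, hwM, h⟩
  obtain ⟨t, ht, hx₂, j₂, hwj₂, hxj₂⟩ := hx₁.exists_add_smul hB hcol hw
    (fun h => hwj.ne' (congrFun h j₁)) fun v hv => by
      by_cases hvM : v ∈ M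
      · by_cases hvj : v = j₁
        · exact hvj ▸ hwj.le
        · exact absurd hv (hpos j₁ hj₁ x₁ hx₁ hxj₁ hxM₁ v hvM hvj).ne'
      · exact (hwM v hvM).ge
  have hj₂ : j₂ ∈ M := by
    by_contra h
    exact hwj₂.ne (hwM j₂ h)
  have hj₁₂ : j₁ ≠ j₂ := by
    rintro rfl
    exact lt_asymm hwj hwj₂
  have hxM₂ : ∀ v ∉ M, (x₁ + t • w) v = 0 := fun u hu => by simp [hxM₁ u hu, hwM u hu]
  have hset : (feasibleSupports B b).filter (· ⊆ M) = {M.erase j₁, M.erase j₂} := by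
    ext F
    rw [hmem]
    simp only [Finset.mem_insert, Finset.mem_singleton]
    constructor
    · rintro ⟨j, hj, rfl, x, hx, hxj, hxM⟩
      by_cases h₁ : j = j₁
      · exact Or.inl (by rw [h₁])
      by_cases h₂ : j = j₂
      · exact Or.inr (by rw [h₂])
      exfalso
      -- As `x₁` vanishes at `j₁`, coordinate `j₁` of `x` gives its position `s` on the line.
      -- Positivity at `j₂` puts `s` before the end `t`; but coordinate `j`, zero at `s` and
      -- decreasing, would then be negative at `t`.
      have hs : 0 < x j₁ / w j₁ := div_pos (hpos j hj x hx hxj hxM j₁ hj₁ (Ne.symm h₁)) hwj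
      have hline : x = x₁ + (x j₁ / w j₁) • w := by
        have := hker (x - x₁ - (x j₁ / w j₁) • w)
          (by rw [Matrix.mulVec_sub, Matrix.mulVec_sub, Matrix.mulVec_smul, hw, hx.mulVec_eq,
            hx₁.mulVec_eq]; simp)
          (fun v hv => by simp [hxM v hv, hxM₁ v hv, hwM v hv])
          (by simp [hxj₁, div_mul_cancel₀ _ hwj.ne'])
        rw [sub_sub, sub_eq_zero] at this
        exact this
      generalize x j₁ / w j₁ = s at hs hline
      have e1 : x₁ j + s * w j = 0 := by
        rw [← hxj]; conv_rhs => rw [hline]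
        simp
      have e2 : 0 < x₁ j₂ + s * w j₂ := by
        have := hpos j hj x hx hxj hxM j₂ hj₂ (Ne.symm h₂)
        rw [hline] at this
        simpa using this
      have e3 : x₁ j₂ + t * w j₂ = 0 := by simpa using hxj₂
      have e4 : 0 < x₁ j + t * w j := by
        simpa using hpos j₂ hj₂ _ hx₂ hxj₂ hxM₂ j hj h₂
      have e5 := hpos j₁ hj₁ x₁ hx₁ hxj₁ hxM₁ j hj h₁
      have hst : s < t := by nlinarith
      have hwj' : w j < 0 := by nlinarith
      nlinarith
    · rintro (rfl | rfl)
      · exact ⟨j₁, hj₁, rfl, x₁, hx₁, hxj₁, hxM₁⟩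
      · exact ⟨j₂, hj₂, rfl, _, hx₂, hxj₂, hxM₂⟩
  rw [hset, Finset.card_pair]
  · exact even_two
  · intro h
    have : j₂ ∈ M.erase j₂ := h ▸ Finset.mem_erase.2 ⟨hj₁₂.symm, hj₂⟩
    simp at this

end FeasibleSupport

/-! ### Scarf's lemma -/

section Slack

variable {R X L : Type*} [DecidableEq R]

/-- The matrix `A` preceded by the slack columns. -/
abbrev Matrix.withSlack (A : Matrix R X ℝ) : Matrix R (R ⊕ X) ℝ :=
  Matrix.fromCols (1 : Matrix R R ℝ) A

theorem Matrix.withSlack_nonneg {A : Matrix R X ℝ} (hA : ∀ i x, 0 ≤ A i x) (i : R) (v : R ⊕ X) :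
    0 ≤ A.withSlack i v := by
  rcases v with j | x
  · simp only [Matrix.fromCols_apply_inl, Matrix.one_apply]
    split_ifs <;> norm_num
  · exact hA i x

theorem Matrix.exists_withSlack_pos {A : Matrix R X ℝ} (hcol : ∀ x, ∃ i, 0 < A i x) (v : R ⊕ X) :
    ∃ i, 0 < A.withSlack i v := by
  rcases v with j | x
  · exact ⟨j, by simp⟩
  · exact hcol x

variable [Fintype R] [Fintype X]

/-- The Scarf lemma for a nondegenerate system: some dominating set of columns supports a
nonnegative solution. -/
theorem IsScarfOrder.exists_isDominating [DecidableEq X] [LinearOrder L] [Nonempty X]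
    {c : R → R ⊕ X → L} (hc : IsScarfOrder c)
    {A : Matrix R X ℝ} (hA : ∀ i x, 0 ≤ A i x) (hcol : ∀ x, ∃ i, 0 < A i x) {b : R → ℝ}
    (hb0 : ∀ i, 0 ≤ b i) (hb : IsNondegenerate A.withSlack b) :
    ∃ D x, IsDominating c D ∧ IsNonnegSolution A.withSlack b x ∧
      ∀ v ∉ D, x v = 0 := by
  let S : Finset (R ⊕ X) := Finset.univ.map Function.Embedding.inl
  have hScard : S.card = Fintype.card R := by simp [S]
  have heven := Finset.even_card_inter_of_cycle_of_cocycle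
    (𝒟 := dominatingCycle c) (ℱ := feasibleSupports A.withSlack b)
    (fun D hD => (mem_dominatingCycle.1 hD).1) (fun F hF => (mem_feasibleSupports.1 hF).1)
    (fun K hK => hc.even_card_dominatingCycle hK)
    (fun M hM => hb.even_card_feasibleSupports (Matrix.withSlack_nonneg hA)
      (Matrix.exists_withSlack_pos hcol) hM) (Sum.inr (Classical.arbitrary X))
  -- Here `b` itself, placed on the slack columns, is a nonnegative solution.
  have hS : S ∈ dominatingCycle c ∩ feasibleSupports A.withSlack b := by
    refine Finset.mem_inter.2 ⟨mem_dominatingCycle.2 ⟨hScard, Or.inr rfl⟩,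
      mem_feasibleSupports.2 ⟨hScard, Sum.elim b 0, ⟨?_, ?_⟩, ?_⟩⟩
    · rintro (i | x)
      · exact hb0 i
      · exact le_rfl
    · rw [Matrix.fromCols_mulVec]
      simp
    · rintro (i | x) h
      · simp [S] at h
      · rfl
  obtain ⟨D, hD, hDS⟩ : ∃ D ∈ dominatingCycle c ∩ feasibleSupports A.withSlack b,
      D ≠ S := by
    by_contra! h
    rw [Finset.eq_singleton_iff_unique_mem.2 ⟨hS, h⟩, Finset.card_singleton] at heven
    exact absurd heven (by decide)
  obtain ⟨h1, h2⟩ := Finset.mem_inter.1 hD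
  obtain ⟨-, x, hx, hxD⟩ := mem_feasibleSupports.1 h2
  exact ⟨D, x, (mem_dominatingCycle.1 h1).2.resolve_right hDS, hx, hxD⟩

end Slack

/-! ### Fractional stable solutions -/

section Preferences

variable {R X L : Type*} [Fintype R] [Fintype X] [LinearOrder L]

/-- Row orders for a hypergraph with preferences: in row `i` the slack column of `i` comes first,
then the incident columns from the worst to the best, then the other proper columns, then the
other slack columns. -/
noncomputable def preferenceOrder (inc : R → X → Prop) (key : R → X → L) (i : R) (v : R ⊕ X) :
    ℕ ×ₗ (WithBot Lᵒᵈ ×ₗ ℕ) :=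
  open Classical in
  -- Smaller keys are better, hence the order dual; the enumeration only breaks ties, for
  -- injectivity.
  toLex (v.elim (fun j => if j = i then 0 else 3) (fun x => if inc i x then 1 else 2),
    toLex (v.elim (fun _ => ⊥) (fun x => ((OrderDual.toDual (key i x) : Lᵒᵈ) : WithBot Lᵒᵈ)),
      (Fintype.equivFin (R ⊕ X) v : ℕ)))

theorem isScarfOrder_preferenceOrder (inc : R → X → Prop) (key : R → X → L) :
    IsScarfOrder (preferenceOrder inc key) where
  injective i v w h := by
    simp only [preferenceOrder, EmbeddingLike.apply_eq_iff_eq, Prod.mk.injEq] at h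
    exact (Fintype.equivFin (R ⊕ X)).injective (Fin.ext h.2.2)
  slack_le i v := by
    by_cases hv : v = Sum.inl i
    · rw [hv]
    · refine (Prod.Lex.toLex_lt_toLex.2 (Or.inl ?_)).le
      rcases v with j | x
      · have : j ≠ i := fun h => hv (h ▸ rfl)
        simp [this]
      · simp only [Sum.elim_inl, Sum.elim_inr, if_true]
        split_ifs <;> norm_num
  lt_slack i j x hj := by
    refine Prod.Lex.toLex_lt_toLex.2 (Or.inl ?_)
    simp only [Sum.elim_inl, Sum.elim_inr, if_neg hj]
    split_ifs <;> norm_num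

open Classical in
/-- Existence of fractional stable solutions of hypergraphs with capacities `b` and preferences:
each hyperedge `x` is dominated at one of its vertices `i`, that is, `i` is saturated and weakly
prefers all the hyperedges in use at `i` to `x`. -/
theorem exists_fractional_stable (inc : R → X → Prop) (hinc : ∀ x, ∃ i, inc i x) {b : R → ℝ}
    (hb : ∀ i, 0 ≤ b i) (key : R → X → L) :
    ∃ y : X → ℝ, (∀ x, 0 ≤ y x) ∧ (∀ i, ∑ x, (if inc i x then y x else 0) ≤ b i) ∧
      ∀ x, ∃ i, inc i x ∧ ∑ x', (if inc i x' then y x' else 0) = b i ∧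
        ∀ x', inc i x' → 0 < y x' → key i x' ≤ key i x := by
  cases isEmpty_or_nonempty X
  · exact ⟨0, fun _ => le_rfl, fun i => by simpa using hb i, fun x => isEmptyElim x⟩
  let A : Matrix R X ℝ := fun i x => if inc i x then 1 else 0
  have hA : ∀ i x, 0 ≤ A i x := fun i x => by
    simp only [A]
    split_ifs <;> norm_num
  have hcol : ∀ x, ∃ i, 0 < A i x := fun x => (hinc x).imp fun i hi => by simp [A, hi]
  have hrow : ∀ (y : R ⊕ X → ℝ) (i : R), A.withSlack.mulVec y i =
      y (Sum.inl i) + ∑ x, (if inc i x then y (Sum.inr x) else 0) := by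
    intro y i
    rw [Matrix.fromCols_mulVec]
    simp [Matrix.mulVec, dotProduct, A]
  -- Stability is phrased through the support set `D` rather than `y`, so that it survives the
  -- limit; an absent slack column then means saturation.
  obtain ⟨D, y, hD, hy, hyD⟩ := exists_isNonnegSolution_of_approx
    (Matrix.withSlack_nonneg hA) (Matrix.exists_withSlack_pos hcol) (b := b)
    (P := fun D => ∀ x, ∃ i, inc i x ∧ Sum.inl i ∉ D ∧
      ∀ x', inc i x' → Sum.inr x' ∈ D → key i x' ≤ key i x) fun ε hε => by
    obtain ⟨b', hb', hgen⟩ := exists_isNondegenerate A.withSlack b hε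
    obtain ⟨D, y, hD, hy, hyD⟩ := (isScarfOrder_preferenceOrder inc key).exists_isDominating
      hA hcol (fun i => (hb i).trans (hb' i).1.le) hgen
    refine ⟨D, y, b', fun x => ?_, hb', hy, hyD⟩
    obtain ⟨i, hi⟩ := hD (Sum.inr x)
    -- If `x` is not incident to its dominating row `i`, then `D` contains neither the slack of `i`
    -- nor a column incident to `i`. The row sum is then zero, although `b' i` is positive as it
    -- lies strictly above `b i`.
    have hincx : inc i x := by
      by_contra hnot
      have hzero : A.withSlack.mulVec y i = 0 := by
        rw [hrow, hyD (Sum.inl i), zero_add]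
        · refine Finset.sum_eq_zero fun x' _ => ?_
          split_ifs with hx'
          · refine hyD _ fun hmem => ?_
            have := (Prod.Lex.toLex_le_toLex.1 (hi _ hmem))
            simp [hnot, hx'] at this
          · rfl
        · intro hmem
          have := (Prod.Lex.toLex_le_toLex.1 (hi _ hmem))
          simp [hnot] at this
      rw [hy.mulVec_eq] at hzero
      linarith [hb i, (hb' i).1]
    refine ⟨i, hincx, fun hmem => ?_, fun x' hx' hmem => ?_⟩
    · have := (Prod.Lex.toLex_le_toLex.1 (hi _ hmem))
      simp [hincx] at this
    · have := (Prod.Lex.toLex_le_toLex.1 (hi _ hmem))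
      simp only [Sum.elim_inr, hincx, hx', if_true, lt_self_iff_false, false_or, true_and] at this
      rcases Prod.Lex.toLex_le_toLex.1 this with h | h
      · exact (OrderDual.toDual_lt_toDual.1 (WithBot.coe_lt_coe.1 h)).le
      · exact (OrderDual.toDual_le_toDual.1 (WithBot.coe_le_coe.1 h.1.le))
  have hsum : ∀ i, y (Sum.inl i) + ∑ x, (if inc i x then y (Sum.inr x) else 0) = b i := fun i => by
    rw [← hrow, hy.mulVec_eq]
  refine ⟨fun x => y (Sum.inr x), fun x => hy.nonneg _, fun i => ?_, fun x => ?_⟩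
  · linarith [hsum i, hy.nonneg (Sum.inl i)]
  · obtain ⟨i, hi, hslack, hpref⟩ := hD x
    refine ⟨i, hi, by simpa [hyD _ hslack] using hsum i, fun x' hx' hpos => hpref x' hx' ?_⟩
    by_contra h
    exact hpos.ne' (hyD _ h)

end Preferences

/-! ### Walks in the time-expanded graph -/

namespace TransitNetwork

variable {S Z I : Type*} {N : TransitNetwork S Z}

/-- A rank that increases along every edge: the time, and for equal times arrivals before
platforms before departures. -/
noncomputable def Node.rank : N.Node → ℝ ×ₗ ℕ
  | .platform _ t _ => toLex (t, 1)
  | .departure z k => toLex (N.dep z k, 2)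
  | .arrival z k => toLex (N.arr z k, 0)

theorem Edge.rank_src_lt_rank_tgt (e : N.Edge) : e.src.rank < e.tgt.rank := by
  cases e with
  | waiting s t t' h h' hlt hcons => exact Prod.Lex.toLex_lt_toLex.2 (Or.inl hlt)
  | boarding z k => exact Prod.Lex.toLex_lt_toLex.2 (Or.inr ⟨rfl, by norm_num⟩)
  | driving z k => exact Prod.Lex.toLex_lt_toLex.2 (Or.inl (N.dep_lt_arr z k))
  | alighting z k => exact Prod.Lex.toLex_lt_toLex.2 (Or.inr ⟨rfl, by norm_num⟩)
  | dwelling z k hk =>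
    rcases (N.arr_le_dep z k hk).lt_or_eq with h | h
    · exact Prod.Lex.toLex_lt_toLex.2 (Or.inl h)
    · exact Prod.Lex.toLex_lt_toLex.2 (Or.inr ⟨h, by norm_num⟩)

namespace IsWalk

theorem append {l₁ l₂ : List N.Edge} {u v w : N.Node} (h₁ : IsWalk u l₁ v) (h₂ : IsWalk v l₂ w) :
    IsWalk u (l₁ ++ l₂) w := by
  induction l₁ generalizing u with
  | nil => exact (show u = v from h₁) ▸ h₂
  | cons e l ih => exact ⟨h₁.1, ih h₁.2⟩

theorem exists_of_append {l₁ l₂ : List N.Edge} {u w : N.Node} (h : IsWalk u (l₁ ++ l₂) w) :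
    ∃ v, IsWalk u l₁ v ∧ IsWalk v l₂ w := by
  induction l₁ generalizing u with
  | nil => exact ⟨u, rfl, h⟩
  | cons e l ih =>
    obtain ⟨v, h₁, h₂⟩ := ih h.2
    exact ⟨v, ⟨h.1, h₁⟩, h₂⟩

theorem rank_lt {l : List N.Edge} {v w : N.Node} (h : IsWalk v l w) :
    ∀ u ∈ l.map Edge.tgt, v.rank < u.rank := by
  induction l generalizing v with
  | nil => simp
  | cons e l ih =>
    have he : v.rank < e.tgt.rank := h.1 ▸ e.rank_src_lt_rank_tgt
    intro u hu
    rcases List.mem_cons.1 hu with rfl | hu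
    · exact he
    · exact he.trans (ih h.2 u hu)

/-- The time-expanded graph is acyclic. -/
theorem nodup {l : List N.Edge} {v w : N.Node} (h : IsWalk v l w) :
    (v :: l.map Edge.tgt).Nodup := by
  induction l generalizing v with
  | nil => simp
  | cons e l ih =>
    exact List.nodup_cons.2 ⟨fun hv => lt_irrefl _ (h.rank_lt v hv), ih h.2⟩

/-- Telescoping. Hence the cost of a path depends only on its start and arrival times. -/
theorem sum_traversalTime {l : List N.Edge} {v w : N.Node} (h : IsWalk v l w) :
    (l.map Edge.traversalTime).sum = w.time - v.time := by
  induction l generalizing v with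
  | nil => simp [show v = w from h]
  | cons e l ih =>
    rw [List.map_cons, List.sum_cons, ih h.2, Edge.traversalTime, h.1]
    ring

theorem exists_tgt_eq_src {l : List N.Edge} {v w : N.Node} (h : IsWalk v l w) {e : N.Edge}
    (he : e ∈ l) (hv : e.src ≠ v) : ∃ e' ∈ l, e'.tgt = e.src := by
  induction l generalizing v with
  | nil => simp at he
  | cons a l ih =>
    rcases List.mem_cons.1 he with rfl | he
    · exact absurd h.1 hv
    · by_cases ha : e.src = a.tgt
      · exact ⟨a, List.mem_cons_self, ha.symm⟩
      · obtain ⟨e', he', h'⟩ := ih h.2 he ha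
        exact ⟨e', List.mem_cons_of_mem _ he', h'⟩

theorem exists_src_eq_tgt {l : List N.Edge} {v w : N.Node} (h : IsWalk v l w) {e : N.Edge}
    (he : e ∈ l) (hw : e.tgt ≠ w) : ∃ e' ∈ l, e'.src = e.tgt := by
  induction l generalizing v with
  | nil => simp at he
  | cons a l ih =>
    rcases List.mem_cons.1 he with rfl | he
    · cases l with
      | nil => exact absurd h.2 hw
      | cons a' l => exact ⟨a', by simp, h.2.1⟩
    · obtain ⟨e', he', h'⟩ := ih h.2 he
      exact ⟨e', List.mem_cons_of_mem _ he', h'⟩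

end IsWalk

namespace Edge

theorem eq_driving_of_src_eq {e : N.Edge} {z : Z} {k : Fin (N.legs z)}
    (h : e.src = .departure z k) : e = driving z k := by
  cases e <;> simp only [src, reduceCtorEq, Node.departure.injEq] at h
  obtain ⟨rfl, h⟩ := h
  cases h
  rfl

theorem eq_driving_of_tgt_eq {e : N.Edge} {z : Z} {k : Fin (N.legs z)}
    (h : e.tgt = .arrival z k) : e = driving z k := by
  cases e <;> simp only [tgt, reduceCtorEq, Node.arrival.injEq] at h
  obtain ⟨rfl, h⟩ := h
  cases h
  rfl

theorem eq_boarding_or_dwelling_of_tgt_eq {e : N.Edge} {z : Z} {k : Fin (N.legs z)}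
    (h : e.tgt = .departure z k) :
    e = boarding z k ∨ ∃ (j : ℕ) (hj : j + 1 < N.legs z), k = ⟨j + 1, hj⟩ ∧ e = dwelling z j hj := by
  cases e <;> simp only [tgt, reduceCtorEq, Node.departure.injEq] at h
  · obtain ⟨rfl, h⟩ := h
    cases h
    exact Or.inl rfl
  · obtain ⟨rfl, h⟩ := h
    cases h
    exact Or.inr ⟨_, _, rfl, rfl⟩

end Edge

/-! ### Boarding, staying on board and splicing -/

namespace Strategy

variable {c : Commodity S}

/-- A path ends on a platform, and a departure node can be left only by its driving edge. -/
theorem driving_mem_of_boarding_mem {x : N.Strategy c} {z : Z} {k : Fin (N.legs z)}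
    (h : Edge.boarding z k ∈ x.edges) : Edge.driving z k ∈ x.edges := by
  rcases x with _ | ⟨p, _, t, ht, hfinish⟩
  · simp [edges] at h
  · obtain ⟨e, he, hsrc⟩ := p.isWalk.exists_src_eq_tgt h (by rw [hfinish]; simp [Edge.tgt])
    exact Edge.eq_driving_of_src_eq hsrc ▸ he

theorem boarding_mem_or_of_driving_mem {x : N.Strategy c} {z : Z} {k : Fin (N.legs z)}
    (h : Edge.driving z k ∈ x.edges) :
    Edge.boarding z k ∈ x.edges ∨ ∃ (j : ℕ) (hj : j + 1 < N.legs z), k = ⟨j + 1, hj⟩ ∧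
      Edge.driving z ⟨j, Nat.lt_of_succ_lt hj⟩ ∈ x.edges := by
  rcases x with _ | ⟨p, ⟨t, ht, hstart, _⟩, _⟩
  · simp [edges] at h
  · obtain ⟨e, he, htgt⟩ := p.isWalk.exists_tgt_eq_src h (by rw [hstart]; simp [Edge.src])
    rcases Edge.eq_boarding_or_dwelling_of_tgt_eq htgt with rfl | ⟨j, hj, hk, rfl⟩
    · exact Or.inl he
    · obtain ⟨e', he', htgt'⟩ := p.isWalk.exists_tgt_eq_src he (by rw [hstart]; simp [Edge.src])
      exact Or.inr ⟨j, hj, hk, Edge.eq_driving_of_tgt_eq htgt' ▸ he'⟩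

open Classical in
/-- The last stop up to stop `k` at which the strategy boards the vehicle `z`. -/
noncomputable def boardingIndex (x : N.Strategy c) (z : Z) (k : ℕ) : ℕ :=
  -- The default value is `0`; `boardingIndex_spec` shows that a passenger of leg `k` really boards
  -- at the index.
  Nat.findGreatest (fun j => ∃ hj : j < N.legs z, Edge.boarding z ⟨j, hj⟩ ∈ x.edges) k

open Classical in
theorem boardingIndex_le (x : N.Strategy c) (z : Z) (k : ℕ) : x.boardingIndex z k ≤ k :=
  Nat.findGreatest_le k

open Classical in
theorem le_boardingIndex {x : N.Strategy c} {z : Z} {j k : ℕ} (hjk : j ≤ k) (hj : j < N.legs z)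
    (h : Edge.boarding z ⟨j, hj⟩ ∈ x.edges) : j ≤ x.boardingIndex z k :=
  Nat.le_findGreatest hjk ⟨hj, h⟩

/-- A passenger of leg `k` boarded at the boarding index and stayed on board since. -/
theorem boardingIndex_spec {x : N.Strategy c} {z : Z} {k : ℕ} (hk : k < N.legs z)
    (h : Edge.driving z ⟨k, hk⟩ ∈ x.edges) :
    (∃ hj : x.boardingIndex z k < N.legs z, Edge.boarding z ⟨_, hj⟩ ∈ x.edges) ∧
      ∀ (m : ℕ) (hm : m < N.legs z), x.boardingIndex z k ≤ m → m ≤ k →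
        Edge.driving z ⟨m, hm⟩ ∈ x.edges := by
  classical
  induction k with
  | zero =>
    have hz : x.boardingIndex z 0 = 0 := Nat.le_zero.1 (x.boardingIndex_le z 0)
    rcases boarding_mem_or_of_driving_mem h with hb | ⟨j, hj, hjk, -⟩
    · refine ⟨⟨by rw [hz]; exact hk, by simpa only [hz] using hb⟩, fun m hm _ hm0 => ?_⟩
      obtain rfl := Nat.le_zero.1 hm0
      exact h
    · simp at hjk
  | succ k ih =>
    by_cases hb : Edge.boarding z ⟨k + 1, hk⟩ ∈ x.edges
    · have hz : x.boardingIndex z (k + 1) = k + 1 :=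
        le_antisymm (x.boardingIndex_le z _) (le_boardingIndex le_rfl hk hb)
      refine ⟨⟨by rw [hz]; exact hk, by simpa only [hz] using hb⟩, fun m hm h1 h2 => ?_⟩
      obtain rfl : m = k + 1 := le_antisymm h2 (hz ▸ h1)
      exact h
    · have hz : x.boardingIndex z (k + 1) = x.boardingIndex z k :=
        Nat.findGreatest_of_not fun ⟨_, h'⟩ => hb h'
      obtain ⟨j, hj, hjk, hdrive⟩ := (boarding_mem_or_of_driving_mem h).resolve_left hb
      obtain rfl : k = j := by simpa using hjk
      obtain ⟨h1, h2⟩ := ih _ hdrive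
      refine ⟨by simpa only [hz] using h1, fun m hm h3 h4 => ?_⟩
      rcases h4.lt_or_eq with h4 | rfl
      · exact h2 m hm (hz ▸ h3) (Nat.lt_succ_iff.1 h4)
      · exact h

end Strategy

theorem _root_.List.forall_not_or_exists_append_cons {α : Type*} (P : α → Prop) (l : List α) :
    (∀ a ∈ l, ¬ P a) ∨ ∃ l₁ a l₂, l = l₁ ++ a :: l₂ ∧ P a ∧ ∀ b ∈ l₂, ¬ P b := by
  induction l with
  | nil => simp
  | cons a l ih =>
    rcases ih with h | ⟨l₁, b, l₂, rfl, hb, hl₂⟩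
    · by_cases ha : P a
      · exact Or.inr ⟨[], a, l, rfl, ha, h⟩
      · refine Or.inl fun b hb => ?_
        rcases List.mem_cons.1 hb with rfl | hb
        · exact ha
        · exact h b hb
    · exact Or.inr ⟨a :: l₁, b, l₂, rfl, hb, hl₂⟩

/-- For a fixed departure time: following `p` up to the last leg driven by `p` that `q` boards, and
`q` from there on, costs the same as `q`. -/
theorem Strategy.exists_splice {c : Commodity S} {θ : ℝ} (hc : c.departureTimes = {θ})
    (p q : N.Strategy c) : ∃ q' : N.Strategy c, q'.cost = q.cost ∧
      ∀ (z : Z) (k : Fin (N.legs z)), Edge.boarding z k ∈ q'.edges →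
        Edge.boarding z k ∈ p.edges ∨
          (Edge.boarding z k ∈ q.edges ∧ Edge.driving z k ∉ p.edges) := by
  rcases List.forall_not_or_exists_append_cons
    (fun e : N.Edge => ∃ z k, e = .boarding z k ∧ Edge.driving z k ∈ p.edges) q.edges with
    h | ⟨l₁, _, l₂, hq, ⟨z, k, rfl, hp⟩, hl₂⟩
  · exact ⟨q, rfl, fun z k hzk => Or.inr ⟨hzk, fun hd => h _ hzk ⟨z, k, rfl, hd⟩⟩⟩
  rcases p with _ | ⟨p, hstart, hfinish⟩
  · simp [edges] at hp
  rcases q with _ | ⟨q, hstart', hfinish'⟩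
  · simp [edges] at hq
  simp only [edges] at hp hq
  obtain ⟨m₁, m₂, hm⟩ := List.append_of_mem hp
  obtain ⟨u, hu, hu'⟩ := (hm ▸ p.isWalk).exists_of_append
  obtain ⟨w, -, hw'⟩ := (hq ▸ q.isWalk).exists_of_append
  -- The pieces meet at the departure node of the leg, the head of the boarding edge in `q` and the
  -- tail of the driving edge in `p`.
  have hwalk : IsWalk p.start (m₁ ++ l₂) q.finish := hu.append (hu'.1 ▸ hw'.2)
  refine ⟨some ⟨⟨p.start, q.finish, m₁ ++ l₂, hwalk, hwalk.nodup⟩, hstart, hfinish'⟩, ?_, ?_⟩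
  · have htime : p.start.time = q.start.time := by
      obtain ⟨t, _, h, ht⟩ := hstart
      obtain ⟨t', _, h', ht'⟩ := hstart'
      rw [hc, Set.mem_singleton_iff] at ht ht'
      rw [h, h', Node.time, Node.time, ht, ht']
    simp only [cost, Path.traversalTime, Path.arrivalTime]
    rw [hwalk.sum_traversalTime, q.isWalk.sum_traversalTime, htime]
  · intro z' k' h
    simp only [edges] at h ⊢
    rcases List.mem_append.1 h with h | h
    · exact Or.inl (hm ▸ List.mem_append_left _ h)
    · exact Or.inr ⟨hq ▸ List.mem_append_right _ (List.mem_cons_of_mem _ h),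
        fun hd => hl₂ _ h ⟨z', k', rfl, hd⟩⟩

/-! ### Stable flows and equilibria -/

namespace FlowVector

variable [Fintype I] [Finite Z] {C : I → Commodity S}

open Classical in
theorem edgeFlow_deviate (f : N.FlowVector C) (i : I) (p q : N.Strategy (C i)) (ε : ℝ)
    (e : N.Edge) : (f.deviate i p q ε).edgeFlow e =
      f.edgeFlow e + ε * ((if e ∈ q.edges then 1 else 0) - if e ∈ p.edges then 1 else 0) := by
  have hsingle : ∀ r : N.Strategy (C i), ∑ j, ∑ s : N.Strategy (C j), (if e ∈ s.edges then
      (Pi.single i (Pi.single r 1) : N.FlowVector C) j s else 0) =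
        if e ∈ r.edges then 1 else 0 := by
    intro r
    rw [Finset.sum_eq_single i, Finset.sum_eq_single r]
    · simp
    · intro s _ hs
      simp [Pi.single_eq_of_ne hs]
    · simp
    · intro j _ hj
      exact Finset.sum_eq_zero fun s _ => by simp [Pi.single_eq_of_ne hj]
    · simp
  rw [← hsingle p, ← hsingle q]
  simp only [edgeFlow, deviate, ← Finset.sum_sub_distrib, Finset.mul_sum, ← Finset.sum_add_distrib]
  refine Finset.sum_congr rfl fun j _ => Finset.sum_congr rfl fun s _ => ?_
  split_ifs <;> simp

/-- If `q` is an available alternative to `p`, then every leg that `q` boards is driven by `p` or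
has residual capacity. -/
theorem edgeFlow_lt_of_mem_availableAlternatives {f : N.FlowVector C} {i : I}
    {p q : N.Strategy (C i)} (h : q ∈ f.availableAlternatives i p) {z : Z} {k : Fin (N.legs z)}
    (hq : Edge.boarding z k ∈ q.edges) (hp : Edge.driving z k ∉ p.edges) :
    f.edgeFlow (.driving z k) < N.capacity z := by
  obtain ⟨ε, hε, -, hadm⟩ := h
  have := hadm z k hq
  rw [edgeFlow_deviate, if_pos (Strategy.driving_mem_of_boarding_mem hq), if_neg hp] at this
  linarith

/-- The preference of a leg: earlier boarding first, then lower cost. -/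
noncomputable def legKey {c : Commodity S} (x : N.Strategy c) (z : Z) (k : ℕ) : ℕ ×ₗ ℝ :=
  toLex (x.boardingIndex z k, x.cost)

/-- A stable flow: every strategy is dominated by its commodity, or by one of the legs it drives. -/
structure IsStable (f : N.FlowVector C) : Prop where
  feasible : f.Feasible
  dominated : ∀ (i : I) (q : N.Strategy (C i)), (∀ p, 0 < f i p → p.cost ≤ q.cost) ∨
    ∃ (z : Z) (k : Fin (N.legs z)), Edge.driving z k ∈ q.edges ∧
      f.edgeFlow (.driving z k) = N.capacity z ∧
      ∀ (j : I) (p : N.Strategy (C j)), Edge.driving z k ∈ p.edges → 0 < f j p →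
        legKey p z k ≤ legKey q z k

theorem exists_isStable (N : TransitNetwork S Z) (C : I → Commodity S) :
    ∃ f : N.FlowVector C, f.IsStable := by
  classical
  have := Fintype.ofFinite Z
  obtain ⟨y, hy, hcap, hdom⟩ := exists_fractional_stable
    (R := I ⊕ ((z : Z) × Fin (N.legs z))) (X := (i : I) × N.Strategy (C i))
    (inc := fun r x => r.elim (fun i => x.1 = i) fun l => Edge.driving l.1 l.2 ∈ x.2.edges)
    (hinc := fun x => ⟨Sum.inl x.1, rfl⟩)
    (b := Sum.elim (fun i => (C i).demand) fun l => N.capacity l.1)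
    (hb := by
      rintro (i | l)
      · exact (C i).demand_nonneg
      · exact N.capacity_nonneg _)
    (key := fun r x => r.elim (fun _ => toLex (0, x.2.cost)) fun l => legKey x.2 l.1 l.2)
  let f : N.FlowVector C := fun i p => y ⟨i, p⟩
  have hdemand : ∀ i, ∑ x : (i : I) × N.Strategy (C i), (if x.1 = i then y x else 0) =
      ∑ p, f i p := by
    intro i
    rw [Fintype.sum_sigma, Finset.sum_eq_single i]
    · simp [f]
    · intro j _ hj
      simp [hj]
    · simp
  have hflow : ∀ e : N.Edge, ∑ x : (i : I) × N.Strategy (C i),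
      (if e ∈ x.2.edges then y x else 0) = f.edgeFlow e := fun e => by
    rw [Fintype.sum_sigma]
    rfl
  refine ⟨f, ⟨⟨⟨fun i p => hy _, fun i => ?_⟩, fun z k => ?_⟩, fun i q => ?_⟩⟩
  -- The outside option drives no leg, so it is dominated at its commodity, which is therefore
  -- saturated: the demand is met exactly.
  · obtain ⟨r, hr, hsat, -⟩ := hdom ⟨i, none⟩
    rcases r with j | l
    · obtain rfl : i = j := hr
      rw [← hdemand]
      convert hsat <;> rfl
    · simp [Strategy.edges] at hr
  · rw [← hflow]
    convert hcap (Sum.inr ⟨z, k⟩) <;> rfl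
  · obtain ⟨r, hr, hsat, hpref⟩ := hdom ⟨i, q⟩
    rcases r with j | ⟨z, k⟩
    · obtain rfl : i = j := hr
      left
      intro p hp
      have := hpref ⟨i, p⟩ rfl hp
      simpa [Prod.Lex.toLex_le_toLex] using this
    · refine Or.inr ⟨z, k, hr, ?_, fun j p hp hpos => hpref ⟨j, p⟩ hp hpos⟩
      rw [← hflow]
      convert hsat <;> rfl

/-- If a strategy is dominated at a leg, then the leg where it boarded is full, and all its
passengers stay on board. -/
theorem edgeFlow_eq_capacity_of_dominated {f : N.FlowVector C} (hf : f.Feasible) {z : Z}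
    {k j : Fin (N.legs z)} (hjk : j ≤ k) (hsat : f.edgeFlow (.driving z k) = N.capacity z)
    (hpref : ∀ (i : I) (p : N.Strategy (C i)), Edge.driving z k ∈ p.edges → 0 < f i p →
      p.boardingIndex z k ≤ j) :
    f.edgeFlow (.driving z j) = N.capacity z ∧ ∀ (i : I) (p : N.Strategy (C i)),
      Edge.driving z j ∈ p.edges → 0 < f i p → Edge.driving z k ∈ p.edges := by
  classical
  -- Users of leg `k` boarded by `j`, so they also drive leg `j`. Its flow is thus at least the full
  -- flow of leg `k` and at most the same capacity; equality holds term by term.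
  have hterm : ∀ (i : I) (p : N.Strategy (C i)), (if Edge.driving z k ∈ p.edges then f i p else 0) ≤
      if Edge.driving z j ∈ p.edges then f i p else 0 := by
    intro i p
    have h0 := hf.1.1 i p
    by_cases hk : Edge.driving z k ∈ p.edges
    · rcases h0.lt_or_eq with hpos | hzero
      · rw [if_pos ((Strategy.boardingIndex_spec k.2 hk).2 j j.2 (hpref i p hk hpos) hjk), if_pos hk]
      · simp [← hzero]
    · rw [if_neg hk]
      split_ifs
      exacts [h0, le_rfl]
  have hle : f.edgeFlow (.driving z k) ≤ f.edgeFlow (.driving z j) :=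
    Finset.sum_le_sum fun i _ => Finset.sum_le_sum fun p _ => hterm i p
  have heq : f.edgeFlow (.driving z j) = N.capacity z := le_antisymm (hf.2 z j) (hsat ▸ hle)
  refine ⟨heq, fun i p hj hpos => ?_⟩
  have h1 := (Finset.sum_eq_sum_iff_of_le fun i _ => Finset.sum_le_sum fun p _ => hterm i p).1
    (hsat.trans heq.symm) i (Finset.mem_univ i)
  have h2 := (Finset.sum_eq_sum_iff_of_le fun p _ => hterm i p).1 h1 p (Finset.mem_univ p)
  by_contra hk
  rw [if_neg hk, if_pos hj] at h2
  exact hpos.ne h2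

theorem IsStable.isUserEquilibrium {f : N.FlowVector C} (hf : f.IsStable)
    (hC : FixedDepartureTimes C) : f.IsUserEquilibrium := by
  refine ⟨hf.feasible, fun i p hp q hq => ?_⟩
  obtain ⟨θ, hθ⟩ := hC i
  obtain ⟨q', hcost, hboard⟩ := Strategy.exists_splice hθ p q
  rw [← hcost]
  rcases hf.dominated i q' with h | ⟨z, k, hk, hsat, hpref⟩
  · exact h p hp
  obtain ⟨⟨hj, hjq⟩, -⟩ := Strategy.boardingIndex_spec k.2 hk
  have hidx : ∀ (l : I) (r : N.Strategy (C l)), Edge.driving z k ∈ r.edges → 0 < f l r →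
      r.boardingIndex z k ≤ q'.boardingIndex z k := by
    intro l r hr hpos
    rcases Prod.Lex.toLex_le_toLex.1 (hpref l r hr hpos) with h | h
    exacts [h.le, h.1.le]
  obtain ⟨hfull, hstay⟩ := edgeFlow_eq_capacity_of_dominated hf.feasible
    (j := ⟨_, hj⟩) (q'.boardingIndex_le z k) hsat hidx
  -- Either `p` boards the full leg too and the tie in boarding stops leaves the cost comparison, or
  -- availability of `q` would require residual capacity there.
  rcases hboard z _ hjq with hjp | ⟨hjq, hjp⟩
  · have hpk := hstay i p (Strategy.driving_mem_of_boarding_mem hjp) hp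
    have hge := Strategy.le_boardingIndex (q'.boardingIndex_le z k) hj hjp
    rcases Prod.Lex.toLex_le_toLex.1 (hpref i p hpk hp) with h | h
    · exact absurd h (not_lt.2 hge)
    · exact h.2
  · exact absurd hfull (edgeFlow_lt_of_mem_availableAlternatives hq hjq hjp).ne

end FlowVector

end TransitNetwork

theorem theorem13 {S Z I : Type*} [Finite Z] [Fintype I] (N : TransitNetwork S Z)
    (C : I → TransitNetwork.Commodity S) (hC : TransitNetwork.FixedDepartureTimes C) :
    ∃ f : N.FlowVector C, f.IsUserEquilibrium := by
  obtain ⟨f, hf⟩ := TransitNetwork.FlowVector.exists_isStable N C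
  exact ⟨f, hf.isUserEquilibrium hC⟩
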